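/- Let $\epsilon>0$ and $K>1$ be fixed real numbers. For large real $T$ put $$P_0=\sqrt{\frac{T}{2\pi}},\qquad P=(\ln P_0)^{1-\epsilon},\qquad \beta=\left[(\ln P_0)^{2\epsilon/3}\right],$$ where $[\cdot]$ is the integer part, and define, with $p$ running over primes, $$\zeta_1(s)=\prod_{p\le P}\sum_{k=0}^{\beta}\frac1{p^{sk}},\qquad \zeta_2(s)=\prod_{p\le P}\sum_{k=0}^{\beta}\frac1{p^{(1-s)k}},\qquad \chi(s)=\pi^{s-\frac12}\,\frac{\Gamma\left(\frac{1-s}{2}\right)}{\Gamma\left(\frac s2\right)},$$ $$\tilde\zeta(s)=\zeta_1(s)+\chi(s)\,\zeta_2(s)\qquad(s\in\mathbb C,\ s\ne 1,3,5,\dots).$$ (Multiplied out, $\zeta_1(s)=\sum' n^{-s}$ and $\zeta_2(s)=\sum' n^{-(1-s)}$, where $n$ runs over the positive integers all of whose prime factors are $\le P$ and occur with multiplicity at most $\beta$; for large $T$ all these $n$ are less than $P_0$.) Theorem. There is a $T_0=T_0(\epsilon,K)>0$ such that for all $T\ge T_0$ and all real $H\le\sqrt T$, $$\tilde\zeta(s)\neq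 0\quad\text{for every } s=\sigma+it \text{ with } \sigma\in[-K,K],\ t\in[T,T+H],\ \sigma\neq\tfrac12 .$$ That is, all zeros of $\tilde\zeta$ in this rectangle lie on the critical line $\sigma=\frac12$. -/

import Mathlib

namespace PartOfZeta

noncomputable section

/-- `P₀ = √(T / 2π)`. -/
def P₀ (T : ℝ) : ℝ := Real.sqrt (T / (2 * Real.pi))

/-- `P = (ln P₀)^(1 - ε)`. -/
def P (ε T : ℝ) : ℝ := Real.log (P₀ T) ^ (1 - ε)

/-- `β = [(ln P₀)^(2ε/3)]`, the integer part. -/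
def β (ε T : ℝ) : ℕ := ⌊Real.log (P₀ T) ^ (2 * ε / 3)⌋₊

/-- The finite set of primes `p ≤ x`. -/
def primesUpTo (x : ℝ) : Finset ℕ := {p ∈ Finset.range (⌊x⌋₊ + 1) | p.Prime}

theorem mem_primesUpTo {x : ℝ} {p : ℕ} : p ∈ primesUpTo x ↔ p.Prime ∧ (p : ℝ) ≤ x := by
  simp only [primesUpTo, Finset.mem_filter, Finset.mem_range, Nat.lt_succ_iff]
  constructor
  · rintro ⟨h, hp⟩
    exact ⟨hp, (Nat.le_floor_iff' hp.ne_zero).1 h⟩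
  · rintro ⟨hp, h⟩
    exact ⟨(Nat.le_floor_iff' hp.ne_zero).2 h, hp⟩

/-- `ζ₁(s) = ∏_{p ≤ P} ∑_{k=0}^{β} p^{-sk}`. -/
def ζ₁ (ε T : ℝ) (s : ℂ) : ℂ :=
  ∏ p ∈ primesUpTo (P ε T), ∑ k ∈ Finset.range (β ε T + 1), 1 / (p : ℂ) ^ (s * (k : ℂ))

/-- `ζ₂(s) = ∏_{p ≤ P} ∑_{k=0}^{β} p^{-(1-s)k}`. -/
def ζ₂ (ε T : ℝ) (s : ℂ) : ℂ :=
  ∏ p ∈ primesUpTo (P ε T), ∑ k ∈ Finset.range (β ε T + 1), 1 / (p : ℂ) ^ ((1 - s) * (k : ℂ))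

/-- The factor of the functional equation of `ζ`:
`χ(s) = π^(s - 1/2) Γ((1 - s)/2) / Γ(s/2)`, for `s ≠ 1, 3, 5, …`. -/
def χ (s : ℂ) : ℂ :=
  (Real.pi : ℂ) ^ (s - 1 / 2) * Complex.Gamma ((1 - s) / 2) / Complex.Gamma (s / 2)

/-- `ζ₃(s) = χ(s) ζ₂(s)`. -/
def ζ₃ (ε T : ℝ) (s : ℂ) : ℂ := χ s * ζ₂ ε T s

/-- The part of the zeta function `ζ̃(s) = ζ₁(s) + ζ₃(s)`. -/
def zetaTilde (ε T : ℝ) (s : ℂ) : ℂ := ζ₁ ε T s + ζ₃ ε T s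

/-- The rectangle `D(T, H, K) = {σ + it : σ ∈ [-K, K], t ∈ [T, T + H]}`. -/
def D (T H K : ℝ) : Set ℂ := {s | s.re ∈ Set.Icc (-K) K ∧ s.im ∈ Set.Icc T (T + H)}

end

end PartOfZeta

namespace PartOfZeta

/-! To the right of the critical line `ζ₁` strictly dominates `ζ₃ = χ ζ₂`, so the sum cannot vanish;
the symmetry `s ↦ 1 - s` carries this to the left side.

Both estimates are exponentials of a multiple of `σ - 1/2`, hence the domination is uniform up to
the line. Prime by prime, the factor of `ζ₂` is the conjugate of that of `ζ₁` with its variable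
dilated by `p ^ (2σ - 1)`, which gives `|ζ₂| ≤ exp ((2σ - 1) · 28 β ∑ log p) |ζ₁|` (`norm_ζ₂_le`).
Euler's limit for `Γ` gives `|χ| ≤ exp (-(σ - 1/2) (log T - O(1)))` (`norm_χ_le`). With `L = log
P₀`, the choice of `P` and `β` makes `β ∑ log p` at most `L ^ (1 - ε/3) log L = o(L)`, so the decay
of `χ` wins. -/

/-! ### Local factors: comparing `ζ₂` with `ζ₁`. -/

theorem norm_geom_sum_lower {z : ℂ} (hz : ‖z‖ ≤ 3 / 4) (n : ℕ) :
    1 / 7 ≤ ‖∑ k ∈ Finset.range (n + 1), z ^ k‖ := by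
  have h := geom_sum_mul z (n + 1)
  have h1 : ‖∑ k ∈ Finset.range (n + 1), z ^ k‖ * ‖z - 1‖ = ‖z ^ (n + 1) - 1‖ := by
    rw [← norm_mul, h]
  have h2 : ‖z - 1‖ ≤ 7 / 4 := (norm_sub_le z 1).trans (by rw [norm_one]; linarith)
  have h3 : ‖z ^ (n + 1)‖ ≤ 3 / 4 := by
    rw [norm_pow, pow_succ]
    have : ‖z‖ ^ n ≤ 1 := pow_le_one₀ (norm_nonneg z) (by linarith)
    nlinarith [norm_nonneg z]
  have h4 : 1 - ‖z ^ (n + 1)‖ ≤ ‖z ^ (n + 1) - 1‖ := by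
    have := norm_sub_norm_le (1 : ℂ) (z ^ (n + 1))
    rwa [norm_one, norm_sub_rev] at this
  nlinarith [norm_nonneg (∑ k ∈ Finset.range (n + 1), z ^ k)]

theorem sum_pow_le_four {x : ℝ} (h0 : 0 ≤ x) (hx : x ≤ 3 / 4) (n : ℕ) :
    ∑ k ∈ Finset.range n, x ^ k ≤ 4 := by
  have h := geom_sum_mul x n
  have h1 : 0 ≤ x ^ n := pow_nonneg h0 n
  have h2 : 0 ≤ ∑ k ∈ Finset.range n, x ^ k := Finset.sum_nonneg fun k _ => pow_nonneg h0 k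
  nlinarith

/-- The dilation changes the sum by at most `4 (r ^ n - 1)`. As the sum has norm at least `1/7`,
this is a relative error of at most `28 (r ^ n - 1)`, which Bernoulli's inequality absorbs into `r ^
(28 n)`. A bound that equals 1 at `r = 1` is essential near the critical line. -/
theorem norm_geom_sum_dilate_le {z : ℂ} (hz : ‖z‖ ≤ 3 / 4) {r : ℝ} (hr : 1 ≤ r) (n : ℕ) :
    ‖∑ k ∈ Finset.range (n + 1), ((r : ℂ) * z) ^ k‖ ≤
      r ^ (28 * n) * ‖∑ k ∈ Finset.range (n + 1), z ^ k‖ := by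
  set F := ∑ k ∈ Finset.range (n + 1), z ^ k with hF
  have h1 : ‖∑ k ∈ Finset.range (n + 1), ((r : ℂ) * z) ^ k - F‖ ≤ (r ^ n - 1) * 4 := by
    rw [hF, ← Finset.sum_sub_distrib]
    calc _ ≤ ∑ k ∈ Finset.range (n + 1), ‖((r : ℂ) * z) ^ k - z ^ k‖ := norm_sum_le _ _
      _ ≤ ∑ k ∈ Finset.range (n + 1), (r ^ n - 1) * ‖z‖ ^ k := by
        refine Finset.sum_le_sum fun k hk => ?_
        have hk' : k ≤ n := Nat.lt_succ_iff.1 (Finset.mem_range.1 hk)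
        have e : ((r : ℂ) * z) ^ k - z ^ k = ((r ^ k - 1 : ℝ) : ℂ) * z ^ k := by
          push_cast; ring
        rw [e, norm_mul, norm_pow, Complex.norm_real, Real.norm_of_nonneg
          (sub_nonneg.2 (one_le_pow₀ hr))]
        gcongr
      _ ≤ _ := by
        rw [← Finset.mul_sum]
        exact mul_le_mul_of_nonneg_left (sum_pow_le_four (norm_nonneg z) hz _)
          (sub_nonneg.2 (one_le_pow₀ hr))
  have h2 := norm_geom_sum_lower hz n
  have h3 : ‖∑ k ∈ Finset.range (n + 1), ((r : ℂ) * z) ^ k‖ ≤ ‖F‖ + (r ^ n - 1) * 4 := by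
    have := norm_add_le F (∑ k ∈ Finset.range (n + 1), ((r : ℂ) * z) ^ k - F)
    rw [add_sub_cancel] at this
    linarith
  have h4 : 1 + 28 * (r ^ n - 1) ≤ r ^ (28 * n) := by
    have := one_add_mul_sub_le_pow (a := r ^ n) (by linarith [one_le_pow₀ hr (n := n)]) 28
    rw [mul_comm 28 n, pow_mul]
    exact_mod_cast this
  have h5 : 0 ≤ r ^ n - 1 := sub_nonneg.2 (one_le_pow₀ hr)
  nlinarith [mul_nonneg h5 (sub_nonneg.2 h2)]

theorem local_factor_eq_geom_sum (p n : ℕ) (w : ℂ) :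
    ∑ k ∈ Finset.range (n + 1), 1 / (p : ℂ) ^ (w * (k : ℂ)) =
      ∑ k ∈ Finset.range (n + 1), ((p : ℂ) ^ (-w)) ^ k := by
  refine Finset.sum_congr rfl fun k _ => ?_
  rw [Complex.cpow_mul_nat, Complex.cpow_neg, one_div, inv_pow]

theorem norm_prime_cpow_neg_le {p : ℕ} (hp : p.Prime) {s : ℂ} (hs : 1 / 2 ≤ s.re) :
    ‖(p : ℂ) ^ (-s)‖ ≤ 3 / 4 := by
  have hp1 : (0 : ℝ) < p := Nat.cast_pos.2 hp.pos
  rw [Complex.norm_natCast_cpow_of_pos hp.pos, Complex.neg_re]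
  have h2 : (2 : ℝ) ≤ p := by exact_mod_cast hp.two_le
  calc (p : ℝ) ^ (-s.re) ≤ (p : ℝ) ^ (-(1 / 2) : ℝ) :=
        Real.rpow_le_rpow_of_exponent_le (by linarith) (by linarith)
    _ = (√p)⁻¹ := by rw [Real.rpow_neg hp1.le, Real.sqrt_eq_rpow]
    _ ≤ 3 / 4 := by
      rw [inv_le_comm₀ (Real.sqrt_pos.2 hp1) (by norm_num)]
      exact Real.le_sqrt_of_sq_le (by norm_num; linarith)

theorem norm_local_factor_one_sub_le {p : ℕ} (hp : p.Prime) {s : ℂ} (hs : 1 / 2 ≤ s.re) (n : ℕ) :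
    ‖∑ k ∈ Finset.range (n + 1), 1 / (p : ℂ) ^ ((1 - s) * (k : ℂ))‖ ≤
      Real.exp ((2 * s.re - 1) * (28 * n * Real.log p)) *
        ‖∑ k ∈ Finset.range (n + 1), 1 / (p : ℂ) ^ (s * (k : ℂ))‖ := by
  have hp0 : (p : ℂ) ≠ 0 := Nat.cast_ne_zero.2 hp.ne_zero
  have hp1 : (0 : ℝ) < p := Nat.cast_pos.2 hp.pos
  -- Since `-(1 - s)` is the conjugate of `(2σ - 1) - s`.
  have hw : (p : ℂ) ^ (-(1 - s)) =
      (starRingEnd ℂ) ((((p : ℝ) ^ (2 * s.re - 1) : ℝ) : ℂ) * (p : ℂ) ^ (-s)) := by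
    have harg : (p : ℂ).arg ≠ Real.pi := by
      rw [Complex.natCast_arg]; exact Real.pi_pos.ne
    rw [map_mul, Complex.conj_ofReal, Complex.ofReal_cpow hp1.le, ← Complex.conj_natCast p,
      ← Complex.cpow_conj _ _ (by simpa using harg)]
    simp only [Complex.conj_natCast, Complex.ofReal_natCast, map_neg]
    rw [← Complex.cpow_add _ _ hp0]
    congr 1
    apply Complex.ext <;> simp; ring
  have hr : (1 : ℝ) ≤ (p : ℝ) ^ (2 * s.re - 1) :=
    Real.one_le_rpow (by exact_mod_cast hp.one_lt.le) (by linarith)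
  rw [local_factor_eq_geom_sum, local_factor_eq_geom_sum, hw]
  simp_rw [← map_pow]
  rw [← map_sum, Complex.norm_conj]
  refine (norm_geom_sum_dilate_le (norm_prime_cpow_neg_le hp hs) hr n).trans_eq ?_
  rw [← Real.rpow_natCast, ← Real.rpow_mul hp1.le, Real.rpow_def_of_pos hp1]
  congr 2
  push_cast; ring

theorem norm_ζ₂_le {ε T : ℝ} {s : ℂ} (hs : 1 / 2 ≤ s.re) :
    ‖ζ₂ ε T s‖ ≤ Real.exp ((2 * s.re - 1) *
      (28 * β ε T * ∑ p ∈ primesUpTo (P ε T), Real.log p)) * ‖ζ₁ ε T s‖ := by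
  rw [ζ₁, ζ₂, norm_prod, norm_prod, Finset.mul_sum, Finset.mul_sum, Real.exp_sum,
    ← Finset.prod_mul_distrib]
  exact Finset.prod_le_prod (fun _ _ => norm_nonneg _) fun p hp =>
    norm_local_factor_one_sub_le (mem_primesUpTo.1 hp).1 hs _

theorem ζ₁_ne_zero {ε T : ℝ} {s : ℂ} (hs : 1 / 2 ≤ s.re) : ζ₁ ε T s ≠ 0 := by
  refine Finset.prod_ne_zero_iff.2 fun p hp h0 => ?_
  have h := norm_geom_sum_lower (norm_prime_cpow_neg_le (mem_primesUpTo.1 hp).1 hs) (β ε T)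
  rw [← local_factor_eq_geom_sum, h0, norm_zero] at h
  norm_num at h

/-! ### Decay of `χ` to the right of the critical line. -/

/-- The squared norms differ by exactly `2 (w.re - z.re) (j + 1/4)`, because the real parts add up
to `1/2`; then `1 + x ≤ exp x`. -/
theorem norm_add_natCast_le {z w : ℂ} (hsum : z.re + w.re = 1 / 2)
    (him : w.im ^ 2 = z.im ^ 2) (h0 : z.im ≠ 0) (j : ℕ) :
    ‖w + j‖ ≤ ‖z + j‖ *
      Real.exp ((w.re - z.re) * ((j + 1 / 4) / ((z.re + j) ^ 2 + z.im ^ 2))) := by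
  have hz : ‖z + j‖ ^ 2 = (z.re + j) ^ 2 + z.im ^ 2 := by
    rw [Complex.sq_norm, Complex.normSq_apply]; simp; ring
  have hw : ‖w + j‖ ^ 2 = (w.re + j) ^ 2 + z.im ^ 2 := by
    rw [Complex.sq_norm, Complex.normSq_apply, ← him]; simp; ring
  have hpos : 0 < (z.re + j) ^ 2 + z.im ^ 2 := by positivity
  refine le_of_sq_le_sq ?_ (by positivity)
  rw [mul_pow, hz, hw, ← Real.exp_nat_mul]
  set D := (z.re + j) ^ 2 + z.im ^ 2 with hD
  have h1 := Real.add_one_le_exp (((2 : ℕ) : ℝ) * ((w.re - z.re) * ((j + 1 / 4) / D)))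
  refine le_trans (le_of_eq ?_) (mul_le_mul_of_nonneg_left h1 hpos.le)
  have : D * (((2 : ℕ) : ℝ) * ((w.re - z.re) * ((j + 1 / 4) / D)) + 1) =
      2 * (w.re - z.re) * (j + 1 / 4) + D := by
    push_cast; field_simp
  rw [this, hD]
  have : z.re = 1 / 2 - w.re := by linarith
  rw [this]; ring

theorem sum_Ico_inv_le_log {m B : ℕ} (hm : B + 1 < m) {n : ℕ} (hn : m ≤ n) :
    ∑ j ∈ Finset.Ico m n, 1 / ((j : ℝ) - B) ≤ Real.log (n - B - 1) - Real.log (m - B - 1) := by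
  induction n, hn using Nat.le_induction with
  | base => simp
  | succ n hn ih =>
    rw [Finset.sum_Ico_succ_top hn]
    have hnB : (B : ℝ) + 1 < n := by exact_mod_cast hm.trans_le hn
    have h1 : (0 : ℝ) < n - B := by linarith
    have h2 : (0 : ℝ) < n - B - 1 := by linarith
    have := Real.one_sub_inv_le_log_of_pos (div_pos h1 h2)
    rw [Real.log_div h1.ne' h2.ne', inv_div] at this
    have e : 1 - ((n : ℝ) - B - 1) / (n - B) = 1 / (n - B) := by field_simp; ring
    push_cast
    rw [show (n : ℝ) + 1 - B - 1 = n - B by ring]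
    linarith

/-- The partial sums of the logarithmic derivative of `|Γ|` in the horizontal direction. -/
theorem sum_range_div_sq_le {a τ : ℝ} {B m n : ℕ} (ha : 1 ≤ 2 * a + B) (hτ : 0 < τ)
    -- The sum is cut at `m`: below it each term is at most `m / τ ^ 2`; above it `(a + j) ^ 2 ≥ j ^
    -- 2 + (1 - B) j` bounds each term by `1 / (j - B)`.
    (hmτ : m ≤ τ) (hm : B + 1 < m) (hn : m ≤ n) :
    ∑ j ∈ Finset.range (n + 1), ((j : ℝ) + 1 / 4) / ((a + j) ^ 2 + τ ^ 2) ≤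
      1 + Real.log n - Real.log (m - B - 1) := by
  have hhead : ∑ j ∈ Finset.range m, ((j : ℝ) + 1 / 4) / ((a + j) ^ 2 + τ ^ 2) ≤ 1 := by
    calc _ ≤ ∑ j ∈ Finset.range m, (m : ℝ) / τ ^ 2 := by
          refine Finset.sum_le_sum fun j hj => ?_
          have hj' : (j : ℝ) + 1 ≤ m := by exact_mod_cast Finset.mem_range.1 hj
          gcongr
          · linarith
          · nlinarith [sq_nonneg (a + j)]
      _ = m * m / τ ^ 2 := by simp [mul_div_assoc]
      _ ≤ 1 := by
        rw [div_le_one (by positivity)]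
        have : (0 : ℝ) ≤ m := Nat.cast_nonneg m
        nlinarith
  have htail : ∑ j ∈ Finset.Ico m (n + 1), ((j : ℝ) + 1 / 4) / ((a + j) ^ 2 + τ ^ 2) ≤
      Real.log n - Real.log (m - B - 1) := by
    calc _ ≤ ∑ j ∈ Finset.Ico m (n + 1), 1 / ((j : ℝ) - B) := by
          refine Finset.sum_le_sum fun j hj => ?_
          have hj' : (B : ℝ) + 1 < j := by exact_mod_cast hm.trans_le (Finset.mem_Ico.1 hj).1
          rw [div_le_div_iff₀ (by positivity) (by linarith)]
          have : (0 : ℝ) ≤ B := Nat.cast_nonneg B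
          nlinarith [sq_nonneg a, sq_nonneg τ]
      _ ≤ _ := sum_Ico_inv_le_log hm (by omega)
      _ ≤ _ := by
        have hnB : (B : ℝ) + 1 < n := by exact_mod_cast hm.trans_le hn
        have : (0 : ℝ) ≤ B := Nat.cast_nonneg B
        have := Real.log_le_log (x := ((n + 1 : ℕ) : ℝ) - B - 1) (y := n)
          (by push_cast; linarith) (by push_cast; linarith)
        linarith
  rw [← Finset.sum_range_add_sum_Ico _ (by omega : m ≤ n + 1)]
  linarith

/-- Compare Euler's sequences `n ^ z n! / ∏ (z + j)` factor by factor: the `log n` from the products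
cancels the one from `n ^ (w - z)`, so the bound survives the limit. -/
theorem norm_Gamma_le_of_re_add_re_eq {z w : ℂ} (hre : z.re ≤ w.re) (hsum : z.re + w.re = 1 / 2)
    {τ : ℝ} (hτ : 0 < τ) (hz : z.im ^ 2 = τ ^ 2) (hw : w.im ^ 2 = τ ^ 2) {B m : ℕ}
    (ha : 1 ≤ 2 * z.re + B) (hmτ : m ≤ τ) (hm : B + 1 < m) :
    ‖Complex.Gamma z‖ ≤
      Real.exp (-((w.re - z.re) * (Real.log (m - B - 1) - 1))) * ‖Complex.Gamma w‖ := by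
  have hz0 : z.im ≠ 0 := fun h => by rw [h] at hz; nlinarith
  have hw0 : w.im ≠ 0 := fun h => by rw [h] at hw; nlinarith
  refine le_of_tendsto_of_tendsto (Complex.GammaSeq_tendsto_Gamma z).norm
    ((Complex.GammaSeq_tendsto_Gamma w).norm.const_mul _) ?_
  filter_upwards [Filter.eventually_ge_atTop m] with n hn
  have hn0 : 0 < n := by omega
  have hn1 : (0 : ℝ) < n := by exact_mod_cast hn0
  have hne {v : ℂ} (hv : v.im ≠ 0) (j : ℕ) : 0 < ‖v + j‖ :=
    norm_pos_iff.2 fun h => hv (by simpa using congrArg Complex.im h)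
  have hprod : ∏ j ∈ Finset.range (n + 1), ‖w + j‖ ≤ (∏ j ∈ Finset.range (n + 1), ‖z + j‖) *
      Real.exp ((w.re - z.re) * (1 + Real.log n - Real.log (m - B - 1))) := by
    calc _ ≤ ∏ j ∈ Finset.range (n + 1), ‖z + j‖ *
          Real.exp ((w.re - z.re) * ((j + 1 / 4) / ((z.re + j) ^ 2 + z.im ^ 2))) :=
          Finset.prod_le_prod (fun _ _ => norm_nonneg _) fun j _ =>
            norm_add_natCast_le hsum (hw.trans hz.symm) hz0 j
      _ ≤ _ := by
        rw [Finset.prod_mul_distrib, ← Real.exp_sum, ← Finset.mul_sum, hz]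
        gcongr
        exact sum_range_div_sq_le ha hτ hmτ hm hn
  have hZ : 0 < ∏ j ∈ Finset.range (n + 1), ‖z + j‖ := Finset.prod_pos fun j _ => hne hz0 j
  have hW : 0 < ∏ j ∈ Finset.range (n + 1), ‖w + j‖ := Finset.prod_pos fun j _ => hne hw0 j
  simp only [Complex.GammaSeq, norm_div, norm_mul, norm_prod,
    Complex.norm_natCast_cpow_of_pos hn0]
  set E := Real.log (m - B - 1) with hE
  rw [← mul_div_assoc, div_le_div_iff₀ hZ hW, Real.rpow_def_of_pos hn1, Real.rpow_def_of_pos hn1]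
  have key : Real.exp (Real.log n * z.re) *
      Real.exp ((w.re - z.re) * (1 + Real.log n - E)) =
      Real.exp (-((w.re - z.re) * (E - 1))) * Real.exp (Real.log n * w.re) := by
    rw [← Real.exp_add, ← Real.exp_add]; ring_nf
  calc _ ≤ Real.exp (Real.log n * z.re) * ‖(n.factorial : ℂ)‖ *
        ((∏ j ∈ Finset.range (n + 1), ‖z + j‖) *
          Real.exp ((w.re - z.re) * (1 + Real.log n - E))) := by gcongr
    _ = (Real.exp (Real.log n * z.re) * Real.exp ((w.re - z.re) * (1 + Real.log n - E))) *
        ‖(n.factorial : ℂ)‖ * (∏ j ∈ Finset.range (n + 1), ‖z + j‖) := by ring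
    _ = _ := by rw [key]; ring

theorem norm_χ_le {s : ℂ} (hs : 1 / 2 ≤ s.re) {B m : ℕ} (hB : s.re ≤ B) (hm : B + 1 < m)
    (hmt : 2 * m ≤ |s.im|) :
    ‖χ s‖ ≤ Real.exp (-((s.re - 1 / 2) *
      (Real.log (m - B - 1) - 1 - Real.log Real.pi))) := by
  have hm0 : (0 : ℝ) < m := by exact_mod_cast (by omega : 0 < m)
  have him : s.im ≠ 0 := fun h => by rw [h, abs_zero] at hmt; linarith
  have h1 : ((1 - s) / 2).re = (1 - s.re) / 2 := by simp
  have h2 : (s / 2).re = s.re / 2 := by simp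
  have h3 : ((1 - s) / 2).im = -(s.im / 2) := by simp [neg_div]
  have h4 : (s / 2).im = s.im / 2 := by simp
  have hG := norm_Gamma_le_of_re_add_re_eq (z := (1 - s) / 2) (w := s / 2) (τ := |s.im| / 2)
    (B := B) (m := m) (by rw [h1, h2]; linarith) (by rw [h1, h2]; ring) (by linarith)
    (by rw [h3, div_pow, sq_abs]; ring) (by rw [h4, div_pow, div_pow, sq_abs])
    (by rw [h1]; linarith) (by linarith) hm
  have hG0 : 0 < ‖Complex.Gamma (s / 2)‖ := by
    refine norm_pos_iff.2 (Complex.Gamma_ne_zero fun k h => him ?_)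
    have := congrArg Complex.im h
    rw [h4] at this
    simp at this
    exact this
  rw [χ, norm_div, norm_mul, div_le_iff₀ hG0, Complex.norm_cpow_eq_rpow_re_of_pos Real.pi_pos,
    Real.rpow_def_of_pos Real.pi_pos]
  refine (mul_le_mul_of_nonneg_left hG (Real.exp_pos _).le).trans_eq ?_
  rw [← mul_assoc, ← Real.exp_add, h1, h2]
  congr 2
  simp
  ring

theorem χ_mul_χ_one_sub {s : ℂ} (hs : s.im ≠ 0) : χ s * χ (1 - s) = 1 := by
  have h {v : ℂ} (hv : v.im ≠ 0) : Complex.Gamma v ≠ 0 :=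
    Complex.Gamma_ne_zero fun k hk => hv (by simpa using congrArg Complex.im hk)
  have h1 : Complex.Gamma (s / 2) ≠ 0 := h (by simpa using hs)
  have h2 : Complex.Gamma ((1 - s) / 2) ≠ 0 := h (by simpa using hs)
  have h3 : (Real.pi : ℂ) ^ (s - 1 / 2) * (Real.pi : ℂ) ^ (1 - s - 1 / 2) = 1 := by
    rw [← Complex.cpow_add _ _ (Complex.ofReal_ne_zero.2 Real.pi_ne_zero)]
    rw [show s - 1 / 2 + (1 - s - 1 / 2) = 0 by ring, Complex.cpow_zero]
  rw [χ, χ, sub_sub_cancel, div_mul_div_comm, div_eq_one_iff_eq (mul_ne_zero h1 h2)]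
  linear_combination (Complex.Gamma (s / 2) * Complex.Gamma ((1 - s) / 2)) * h3

/-! ### Sizes of the exponents for large `T`. -/

open Filter

/-- The trivial count of at most `x` primes suffices. A nonnegative `y` replaces `log x`, which is
negative for `x = P` when `ε > 1` and `log P₀ > 1`. -/
theorem sum_log_primesUpTo_le {x : ℝ} (hx : 0 ≤ x) {y : ℝ} (hy : Real.log x ≤ y) (hy0 : 0 ≤ y) :
    ∑ p ∈ primesUpTo x, Real.log p ≤ x * y := by
  have hcard : ((primesUpTo x).card : ℝ) ≤ x := by
    have hsub : primesUpTo x ⊆ Finset.Icc 1 ⌊x⌋₊ := fun p hp => by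
      obtain ⟨h1, h2⟩ := mem_primesUpTo.1 hp
      exact Finset.mem_Icc.2 ⟨h1.pos, Nat.le_floor h2⟩
    have := Finset.card_le_card hsub
    rw [Nat.card_Icc, Nat.add_sub_cancel] at this
    exact (Nat.cast_le.2 this).trans (Nat.floor_le hx)
  calc _ ≤ ∑ _p ∈ primesUpTo x, y := Finset.sum_le_sum fun p hp => by
        obtain ⟨h1, h2⟩ := mem_primesUpTo.1 hp
        exact (Real.log_le_log (Nat.cast_pos.2 h1.pos) h2).trans hy
    _ = (primesUpTo x).card * y := by rw [Finset.sum_const, nsmul_eq_mul]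
    _ ≤ x * y := by gcongr

theorem β_mul_sum_log_le {ε T : ℝ} (hε : 0 < ε) (hT : 1 ≤ Real.log (P₀ T)) :
    β ε T * ∑ p ∈ primesUpTo (P ε T), Real.log p ≤
      Real.log (P₀ T) ^ (1 - ε / 3) * Real.log (Real.log (P₀ T)) := by
  set L := Real.log (P₀ T) with hL
  have hL0 : 0 < L := by linarith
  have hlog : 0 ≤ Real.log L := Real.log_nonneg hT
  have hP : Real.log (P ε T) ≤ Real.log L := by
    rw [P, ← hL, Real.log_rpow hL0]
    nlinarith
  calc _ ≤ L ^ (2 * ε / 3) * (L ^ (1 - ε) * Real.log L) := by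
        refine mul_le_mul (Nat.floor_le (by positivity))
          (sum_log_primesUpTo_le (Real.rpow_nonneg hL0.le _) hP hlog)
          (Finset.sum_nonneg fun p _ => Real.log_natCast_nonneg p) (by positivity)
    _ = _ := by rw [← mul_assoc, ← Real.rpow_add hL0]; ring_nf

theorem tendsto_P₀_atTop : Tendsto P₀ atTop atTop :=
  Real.tendsto_sqrt_atTop.comp (tendsto_id.atTop_div_const (by positivity))

theorem eventually_exponent_lt {ε : ℝ} (hε : 0 < ε) :
    ∀ᶠ T in atTop, 2 * (28 * β ε T * ∑ p ∈ primesUpTo (P ε T), Real.log p) <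
      Real.log (P₀ T) := by
  have h := ((isLittleO_log_rpow_atTop (by positivity : 0 < ε / 3)).bound
    (by norm_num : (0 : ℝ) < 1 / 100)).and (eventually_ge_atTop (1 : ℝ))
  filter_upwards [(Real.tendsto_log_atTop.comp tendsto_P₀_atTop).eventually h] with T hT
  simp only [Function.comp_apply] at hT
  obtain ⟨h1, h2⟩ := hT
  have h3 := β_mul_sum_log_le hε h2
  set L := Real.log (P₀ T)
  have hL0 : 0 < L := by linarith
  rw [Real.norm_of_nonneg (Real.log_nonneg h2), Real.norm_of_nonneg (by positivity)] at h1
  have h4 : L ^ (1 - ε / 3) * Real.log L ≤ 1 / 100 * L := by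
    calc _ ≤ L ^ (1 - ε / 3) * (1 / 100 * L ^ (ε / 3)) := by gcongr
      _ = 1 / 100 * L ^ (1 - ε / 3 + ε / 3) := by rw [Real.rpow_add hL0]; ring
      _ = _ := by rw [sub_add_cancel, Real.rpow_one]
  linarith

theorem eventually_P₀_le (B : ℕ) :
    ∀ᶠ T in atTop, B + 1 < ⌊T / 2⌋₊ ∧
      Real.log (P₀ T) ≤ Real.log (⌊T / 2⌋₊ - B - 1) - 1 - Real.log Real.pi := by
  set c : ℝ := Real.exp 1 * Real.pi
  have hc : 0 < c := by positivity
  filter_upwards [eventually_gt_atTop (4 * ((B : ℝ) + 2)), eventually_ge_atTop ((4 * c) ^ 2),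
    eventually_gt_atTop 0] with T h1 h2 h3
  have hfl := Nat.lt_floor_add_one (T / 2)
  -- There is ample room: `T / 4` is compared with `e π P₀`, of order only `√T`.
  have h4 : T / 4 ≤ ⌊T / 2⌋₊ - B - 1 := by linarith
  refine ⟨by exact_mod_cast (by linarith : (B : ℝ) + 1 < ⌊T / 2⌋₊), ?_⟩
  have hP : 0 < P₀ T := Real.sqrt_pos.2 (by positivity)
  have hP' : P₀ T ≤ √T := Real.sqrt_le_sqrt (div_le_self h3.le (by linarith [Real.pi_gt_three]))
  have h5 : c * P₀ T ≤ T / 4 := by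
    have h6 : 4 * c ≤ √T := Real.le_sqrt_of_sq_le h2
    nlinarith [Real.mul_self_sqrt h3.le]
  have h7 := Real.log_le_log (by positivity) (h5.trans h4)
  rw [Real.log_mul hc.ne' hP.ne', Real.log_mul (Real.exp_pos 1).ne' Real.pi_ne_zero,
    Real.log_exp] at h7
  linarith

/-- To the right of the critical line the first summand of `ζ̃` dominates. -/
theorem eventually_norm_ζ₃_lt_norm_ζ₁ {ε : ℝ} (hε : 0 < ε) (M : ℝ) :
    ∀ᶠ T in atTop, ∀ s : ℂ, 1 / 2 < s.re → s.re ≤ M → T ≤ |s.im| →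
      ‖ζ₃ ε T s‖ < ‖ζ₁ ε T s‖ := by
  filter_upwards [eventually_exponent_lt hε, eventually_P₀_le ⌈M⌉₊, eventually_ge_atTop 0]
    with T h1 h2 h3 s hs hsM him
  have hχ := norm_χ_le hs.le (hsM.trans (Nat.le_ceil M)) h2.1
    (by linarith [Nat.floor_le (by positivity : 0 ≤ T / 2)])
  rw [ζ₃, norm_mul]
  refine (mul_le_mul hχ (norm_ζ₂_le hs.le) (norm_nonneg _) (Real.exp_pos _).le).trans_lt ?_
  rw [← mul_assoc, ← Real.exp_add]
  refine mul_lt_of_lt_one_left (norm_pos_iff.2 (ζ₁_ne_zero hs.le)) (Real.exp_lt_one_iff.2 ?_)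
  -- The total exponent is `σ - 1/2 > 0` times a quantity made negative by `h1` and `h2`.
  nlinarith

/-! ### Functional equation and conclusion. -/

theorem ζ₁_one_sub (ε T : ℝ) (s : ℂ) : ζ₁ ε T (1 - s) = ζ₂ ε T s := rfl

theorem ζ₂_one_sub (ε T : ℝ) (s : ℂ) : ζ₂ ε T (1 - s) = ζ₁ ε T s := by
  rw [ζ₁, ζ₂, sub_sub_cancel]

theorem zetaTilde_eq_χ_mul {ε T : ℝ} {s : ℂ} (hs : s.im ≠ 0) :
    zetaTilde ε T s = χ s * zetaTilde ε T (1 - s) := by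
  rw [zetaTilde, zetaTilde, ζ₃, ζ₃, ζ₁_one_sub, ζ₂_one_sub]
  linear_combination (-ζ₁ ε T s) * χ_mul_χ_one_sub hs

end PartOfZeta

theorem mainTheorem1 (ε : ℝ) (hε : 0 < ε) (K : ℝ) (hK : 1 < K) :
    ∃ T₀ : ℝ, 0 < T₀ ∧ ∀ T : ℝ, T₀ ≤ T → ∀ H : ℝ, H ≤ Real.sqrt T →
      ∀ s : ℂ, s ∈ PartOfZeta.D T H K → s.re ≠ 1 / 2 →
        PartOfZeta.zetaTilde ε T s ≠ 0 := by
  obtain ⟨T₁, hT₁⟩ :=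
    -- The bound `K + 1` makes room for the reflected point, whose real part `1 - σ` can reach `1 +
    -- K`.
    Filter.eventually_atTop.1 (PartOfZeta.eventually_norm_ζ₃_lt_norm_ζ₁ hε (K + 1))
  refine ⟨max T₁ 1, by positivity, fun T hT H _ s ⟨⟨hl, hr⟩, him, _⟩ hne => ?_⟩
  have hT1 : 1 ≤ T := (le_max_right _ _).trans hT
  have him0 : s.im ≠ 0 := by linarith
  have hdom := hT₁ T ((le_max_left _ _).trans hT)
  have hright (w : ℂ) (hw : 1 / 2 < w.re) (hwK : w.re ≤ K + 1) (hwT : T ≤ |w.im|) :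
      PartOfZeta.zetaTilde ε T w ≠ 0 := fun h0 => by
    have := hdom w hw hwK hwT
    rw [eq_neg_of_add_eq_zero_left h0, norm_neg] at this
    exact lt_irrefl _ this
  rcases lt_or_gt_of_ne hne with h | h
  · rw [PartOfZeta.zetaTilde_eq_χ_mul him0]
    refine mul_ne_zero (left_ne_zero_of_mul_eq_one (PartOfZeta.χ_mul_χ_one_sub him0))
      (hright (1 - s) ?_ ?_ ?_)
    · simp only [Complex.sub_re, Complex.one_re]; linarith
    · simp only [Complex.sub_re, Complex.one_re]; linarith
    · simpa using him.trans (le_abs_self _)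
  · exact hright s h (by linarith) (him.trans (le_abs_self _))
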